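/- Let $(\mathcal{A},\mathbb{E},\mathfrak{s})$ be an extriangulated category in the sense of Nakaoka–Palu: $\mathcal A$ is an additive category, $\mathbb{E}\colon\mathcal{A}^{\mathrm{op}}\times\mathcal{A}\to\mathrm{Ab}$ is an additive bifunctor, and $\mathfrak{s}$ is an additive realization of $\mathbb{E}$ such that axioms (ET3), (ET3)$^{\mathrm{op}}$, (ET4) and (ET4)$^{\mathrm{op}}$ hold. An $\mathbb{E}$-triangle $X\xrightarrow{x}L\xrightarrow{y}M\overset{\delta}{\dashrightarrow}$ consists of $\delta\in\mathbb{E}(M,X)$ and a sequence with $\mathfrak{s}(\delta)=[X\xrightarrow{x}L\xrightarrow{y}M]$; then $x$ is called an inflation with cone $M$. Let $\mathcal{X}$ be a simple-minded system in $\mathcal{A}$, that is, a collection of objects closed under isomorphism such that (a) the endomorphism ring of every $X\in\mathcal{X}$ is a division ring, and $\mathrm{Hom}(X_1,X_2)=0$ for any two non-isomorphic $X_1,X_2\in\mathcal{X}$; (b) every object $M$ of $\mathcal{A}$ admits an $\mathcal{X}$-filtration, i.e. a finite chain of inflations $0=M_0\to M_1\to\cdots\to M_n=M$ (of length $n\ge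 0$) whose cones all lie in $\mathcal{X}$. For an object $M$ let $l_{\mathcal{X}}(M)\in\mathbb{N}$ be the minimal length of an $\mathcal{X}$-filtration of $M$. Then $(\mathcal{A},l_{\mathcal{X}})$ is an extriangulated length category, which means the following. (1) $l_{\mathcal{X}}$ is a length function: it is constant on isomorphism classes; $l_{\mathcal{X}}(M)=0$ if and only if $M\cong 0$; and for every $\mathbb{E}$-triangle $X\to L\to M\overset{\delta}{\dashrightarrow}$ one has $l_{\mathcal{X}}(L)\le l_{\mathcal{X}}(X)+l_{\mathcal{X}}(M)$, with equality if $\delta=0$. (2) Every morphism $f\colon M\to N$ in $\mathcal{A}$ is $l_{\mathcal{X}}$-admissible: there are an object $X_f$, an $l_{\mathcal{X}}$-deflation $i_f\colon M\to X_f$ and an $l_{\mathcal{X}}$-inflation $j_f\colon X_f\to N$ with $f=j_f i_f$. Here an $l_{\mathcal{X}}$-inflation (resp. $l_{\mathcal{X}}$-deflation) is the map $x$ (resp. $y$) in some $\mathbb{E}$-triangle $X\xrightarrow{x}L\xrightarrow{y}M\dashrightarrow$ with $l_{\mathcal{X}}(L)=l_{\mathcal{X}}(X)+l_{\mathcal{X}}(M)$.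 -/

import Mathlib

open CategoryTheory CategoryTheory.Limits Opposite

universe w v u

namespace Extri

section Bifunctor

variable {C : Type u} [Category.{v} C] (E : Cᵒᵖ ⥤ C ⥤ AddCommGrpCat.{w})

/-- The abelian group `𝔼(Z, X)` of extensions. -/
abbrev Extn (Z X : C) : Type w := (E.obj (op Z)).obj X

/-- `a_* δ = 𝔼(Z, a)(δ)`. -/
def push {Z X X' : C} (a : X ⟶ X') (δ : Extn E Z X) : Extn E Z X' :=
  ((E.obj (op Z)).map a).hom δ

/-- `c^* δ = 𝔼(c, X)(δ)`. -/
def pull {Z Z' X : C} (c : Z' ⟶ Z) (δ : Extn E Z X) : Extn E Z' X :=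
  ((E.map c.op).app X).hom δ

/-- The direct sum `δ ⊕ δ'` of two extensions: the element of `𝔼(Z ⊞ Z', X ⊞ X')` that corresponds
to `(δ, 0, 0, δ')` under the decomposition given by the additivity of `𝔼`. -/
noncomputable def directSum [Preadditive C] [HasBinaryBiproducts C] {Z X Z' X' : C}
    (δ : Extn E Z X) (δ' : Extn E Z' X') : Extn E (Z ⊞ Z') (X ⊞ X') :=
  push E biprod.inl (pull E biprod.fst δ) + push E biprod.inr (pull E biprod.snd δ')

end Bifunctor

/-- An extriangulated structure (Nakaoka–Palu) on an additive category `C`.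

The realization `𝔰`, which assigns to each `δ ∈ 𝔼(Z, X)` an equivalence class of sequences
`X ⟶ Y ⟶ Z`, is given by the relation `Tri x y δ`, meaning `𝔰(δ) = [X --x--> Y --y--> Z]`, i.e.
`X --x--> Y --y--> Z --δ-->` is an `𝔼`-triangle. -/
structure ExtriStructure (C : Type u) [Category.{v} C] [Preadditive C] [HasZeroObject C]
    [HasBinaryBiproducts C] where
  /-- the bifunctor `𝔼 : Cᵒᵖ × C ⥤ Ab` -/
  E : Cᵒᵖ ⥤ C ⥤ AddCommGrpCat.{w}
  -- (ET1) `𝔼` is additive in each variable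
  additive_right : ∀ Z : C, (E.obj (op Z)).Additive
  additive_left : ∀ X : C, (E.flip.obj X).Additive
  /-- the relation `𝔰(δ) = [x, y]` -/
  Tri : ∀ {X Y Z : C}, (X ⟶ Y) → (Y ⟶ Z) → Extn E Z X → Prop
  -- the sequences realizing a given `δ` form exactly one equivalence class
  exists_tri : ∀ {X Z : C} (δ : Extn E Z X), ∃ (Y : C) (x : X ⟶ Y) (y : Y ⟶ Z), Tri x y δ
  tri_unique : ∀ {X Y Y' Z : C} {δ : Extn E Z X} {x : X ⟶ Y} {y : Y ⟶ Z}
    {x' : X ⟶ Y'} {y' : Y' ⟶ Z}, Tri x y δ → Tri x' y' δ →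
    ∃ e : Y ≅ Y', x ≫ e.hom = x' ∧ e.hom ≫ y' = y
  tri_of_iso : ∀ {X Y Y' Z : C} {δ : Extn E Z X} {x : X ⟶ Y} {y : Y ⟶ Z}
    {x' : X ⟶ Y'} {y' : Y' ⟶ Z} (e : Y ≅ Y'), x ≫ e.hom = x' → e.hom ≫ y' = y →
    Tri x y δ → Tri x' y' δ
  -- (ET2) `𝔰` is a realization ...
  realize_hom : ∀ {X Y Z X' Y' Z' : C} {x : X ⟶ Y} {y : Y ⟶ Z} {δ : Extn E Z X}
    {x' : X' ⟶ Y'} {y' : Y' ⟶ Z'} {δ' : Extn E Z' X'}, Tri x y δ → Tri x' y' δ' →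
    ∀ (a : X ⟶ X') (c : Z ⟶ Z'), push E a δ = pull E c δ' →
    ∃ b : Y ⟶ Y', x ≫ b = a ≫ x' ∧ y ≫ c = b ≫ y'
  -- ... which is additive
  tri_zero : ∀ X Z : C, Tri (biprod.inl : X ⟶ X ⊞ Z) (biprod.snd : X ⊞ Z ⟶ Z) (0 : Extn E Z X)
  tri_directSum : ∀ {X Y Z X' Y' Z' : C} {x : X ⟶ Y} {y : Y ⟶ Z} {δ : Extn E Z X}
    {x' : X' ⟶ Y'} {y' : Y' ⟶ Z'} {δ' : Extn E Z' X'}, Tri x y δ → Tri x' y' δ' →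
    Tri (biprod.map x x') (biprod.map y y') (directSum E δ δ')
  -- (ET3)
  et3 : ∀ {X Y Z X' Y' Z' : C} {x : X ⟶ Y} {y : Y ⟶ Z} {δ : Extn E Z X}
    {x' : X' ⟶ Y'} {y' : Y' ⟶ Z'} {δ' : Extn E Z' X'}, Tri x y δ → Tri x' y' δ' →
    ∀ (a : X ⟶ X') (b : Y ⟶ Y'), x ≫ b = a ≫ x' →
    ∃ c : Z ⟶ Z', y ≫ c = b ≫ y' ∧ push E a δ = pull E c δ'
  -- (ET3)ᵒᵖ
  et3_op : ∀ {X Y Z X' Y' Z' : C} {x : X ⟶ Y} {y : Y ⟶ Z} {δ : Extn E Z X}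
    {x' : X' ⟶ Y'} {y' : Y' ⟶ Z'} {δ' : Extn E Z' X'}, Tri x y δ → Tri x' y' δ' →
    ∀ (b : Y ⟶ Y') (c : Z ⟶ Z'), y ≫ c = b ≫ y' →
    ∃ a : X ⟶ X', x ≫ b = a ≫ x' ∧ push E a δ = pull E c δ'
  -- (ET4)
  et4 : ∀ {A B D K F : C} {f : A ⟶ B} {f' : B ⟶ D} {δ : Extn E D A}
    {g : B ⟶ K} {g' : K ⟶ F} {δ' : Extn E F B}, Tri f f' δ → Tri g g' δ' →
    ∃ (L : C) (h' : K ⟶ L) (d : D ⟶ L) (e : L ⟶ F) (δ'' : Extn E L A),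
      Tri (f ≫ g) h' δ'' ∧ f' ≫ d = g ≫ h' ∧ h' ≫ e = g' ∧
      Tri d e (push E f' δ') ∧ pull E d δ'' = δ ∧ push E f δ'' = pull E e δ'
  -- (ET4)ᵒᵖ
  et4_op : ∀ {A B D K F : C} {f' : D ⟶ A} {f : A ⟶ B} {δ : Extn E B D}
    {g' : F ⟶ B} {g : B ⟶ K} {δ' : Extn E K F}, Tri f' f δ → Tri g' g δ' →
    ∃ (L : C) (d : D ⟶ L) (e : L ⟶ F) (h' : L ⟶ A) (δ'' : Extn E K L),
      Tri h' (f ≫ g) δ'' ∧ d ≫ h' = f' ∧ h' ≫ f = e ≫ g' ∧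
      Tri d e (pull E g' δ) ∧ push E e δ'' = δ' ∧ push E d δ = pull E g δ''

section Semibrick

variable {C : Type u} [Category.{v} C] [Preadditive C]

/-- A brick: an object whose endomorphism ring is a division ring. -/
def IsBrick (X : C) : Prop :=
  Nontrivial (End X) ∧ ∀ f : End X, f ≠ 0 → IsUnit f

/-- A semibrick: a collection of isomorphism classes of bricks with no nonzero morphisms between
non-isomorphic members. -/
structure IsSemibrick (𝒳 : ObjectProperty C) : Prop where
  closed : 𝒳.IsClosedUnderIsomorphisms
  brick : ∀ X : C, 𝒳 X → IsBrick X
  hom_zero : ∀ X Y : C, 𝒳 X → 𝒳 Y → ¬ Nonempty (X ≅ Y) → ∀ f : X ⟶ Y, f = 0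

end Semibrick

namespace ExtriStructure

variable {C : Type u} [Category.{v} C] [Preadditive C] [HasZeroObject C] [HasBinaryBiproducts C]
  (S : ExtriStructure.{w} C)

/-- `S.HasFiltration 𝒳 n M`: there is a filtration `0 = M₀ ⟶ M₁ ⟶ ⋯ ⟶ Mₙ = M` of length `n` whose
maps are inflations with cones in `𝒳`. -/
inductive HasFiltration (𝒳 : ObjectProperty C) : ℕ → C → Prop
  | zero {M : C} (hM : IsZero M) : HasFiltration 𝒳 0 M
  | succ {n : ℕ} {M N X : C} (hM : HasFiltration 𝒳 n M) (f : M ⟶ N) (g : N ⟶ X)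
      (δ : Extn S.E X M) (h : S.Tri f g δ) (hX : 𝒳 X) : HasFiltration 𝒳 (n + 1) N

/-- The filtration subcategory `Filt(𝒳)`. -/
def Filt (𝒳 : ObjectProperty C) : ObjectProperty C :=
  fun M => ∃ n, S.HasFiltration 𝒳 n M

/-- The `𝒳`-length of `M`: the minimal length of an `𝒳`-filtration of `M`
(meaningful for `M` in `Filt(𝒳)`). -/
noncomputable def filtLength (𝒳 : ObjectProperty C) (M : C) : ℕ :=
  sInf {n | S.HasFiltration 𝒳 n M}

/-- A simple-minded system: a semibrick `𝒳` such that every object lies in `Filt(𝒳)`. -/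
structure IsSimpleMindedSystem (𝒳 : ObjectProperty C) : Prop where
  semibrick : IsSemibrick 𝒳
  filt_eq_top : ∀ M : C, S.Filt 𝒳 M

/-- A length function, i.e. a suitable map from isomorphism classes of objects to `ℕ`. -/
structure IsLengthFunction (Θ : C → ℕ) : Prop where
  iso_invariant : ∀ X Y : C, Nonempty (X ≅ Y) → Θ X = Θ Y
  eq_zero_iff : ∀ X : C, Θ X = 0 ↔ IsZero X
  subadditive : ∀ {X L M : C} (x : X ⟶ L) (y : L ⟶ M) (δ : Extn S.E M X),
    S.Tri x y δ → Θ L ≤ Θ X + Θ M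
  additive_of_split : ∀ {X L M : C} (x : X ⟶ L) (y : L ⟶ M),
    S.Tri x y (0 : Extn S.E M X) → Θ L = Θ X + Θ M

/-- A `Θ`-stable `𝔼`-triangle. -/
def IsStable (Θ : C → ℕ) {X L M : C} (x : X ⟶ L) (y : L ⟶ M) (δ : Extn S.E M X) : Prop :=
  S.Tri x y δ ∧ Θ L = Θ X + Θ M

/-- A `Θ`-inflation: the first map of a `Θ`-stable `𝔼`-triangle. -/
def IsInflation (Θ : C → ℕ) {X L : C} (x : X ⟶ L) : Prop :=
  ∃ (M : C) (y : L ⟶ M) (δ : Extn S.E M X), S.IsStable Θ x y δ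

/-- A `Θ`-deflation: the second map of a `Θ`-stable `𝔼`-triangle. -/
def IsDeflation (Θ : C → ℕ) {L M : C} (y : L ⟶ M) : Prop :=
  ∃ (X : C) (x : X ⟶ L) (δ : Extn S.E M X), S.IsStable Θ x y δ

/-- `f` is `Θ`-admissible: it is a `Θ`-deflation followed by a `Θ`-inflation. -/
def IsAdmissible (Θ : C → ℕ) {M N : C} (f : M ⟶ N) : Prop :=
  ∃ (X : C) (i : M ⟶ X) (j : X ⟶ N), S.IsDeflation Θ i ∧ S.IsInflation Θ j ∧ i ≫ j = f

/-- `(C, Θ)` is an extriangulated length category. -/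
structure IsLengthCategory (Θ : C → ℕ) : Prop where
  lengthFunction : S.IsLengthFunction Θ
  admissible : ∀ {M N : C} (f : M ⟶ N), S.IsAdmissible Θ f

end ExtriStructure

end Extri

namespace Extri

/-! Members of `𝒳` behave like simple objects. By Schur's lemma and (ET4), any nonzero map `M ⟶ T`
with `T` in `𝒳` is a deflation whose fiber has a filtration one step shorter, and dually for `T ⟶ M`
(`exists_fiber`, `exists_cone`). Applied to a minimal filtration, with subadditivity, this makes
every such map stable.

Peeling off one factor at a time shows that length is monotone on retracts and additive on
biproducts, which gives the length function. For admissibility, a map that kills a nonzero `T ⟶ M`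
factors through its cone, and a map killed by a nonzero `N ⟶ T` factors through its fiber. Each
reduction lowers the total length by one. A map that allows neither is an isomorphism
(`isIso_of_comp_ne_zero`). -/

theorem isIso_of_sub_sq_eq_zero {C : Type u} [Category.{v} C] [Preadditive C] {W : C} (w : W ⟶ W)
    (hw : (𝟙 W - w) ≫ (𝟙 W - w) = 0) :
    IsIso w := by
  have h : 𝟙 W - w - w + w ≫ w = 0 := by
    rw [← hw]
    simp only [Preadditive.sub_comp, Preadditive.comp_sub, Category.id_comp, Category.comp_id]
    abel
  refine ⟨𝟙 W + (𝟙 W - w), ?_, ?_⟩ <;>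
  · simp only [Preadditive.add_comp, Preadditive.comp_add, Preadditive.comp_sub,
      Preadditive.sub_comp, Category.id_comp, Category.comp_id]
    rw [← sub_eq_zero, ← neg_eq_zero, ← h]
    abel

theorem isIso_of_isIso_comp {C : Type u} [Category.{v} C] {A B : C} (f : A ⟶ B) (g : B ⟶ A)
    (h₁ : IsIso (f ≫ g)) (h₂ : IsIso (g ≫ f)) : IsIso f := by
  have : IsSplitMono f := ⟨⟨⟨g ≫ inv (f ≫ g), by rw [← Category.assoc, IsIso.hom_inv_id]⟩⟩⟩
  have : Epi f := epi_of_epi g f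
  exact isIso_of_epi_of_isSplitMono f

namespace ExtriStructure

variable {C : Type u} [Category.{v} C] [Preadditive C] [HasZeroObject C] [HasBinaryBiproducts C]
  (S : ExtriStructure.{w} C)

/-! ### Functoriality and additivity of extensions -/

section Extensions

theorem push_id {Z X : C} (δ : Extn S.E Z X) : push S.E (𝟙 X) δ = δ := by
  simp [push]

theorem push_comp {Z X X' X'' : C} (a : X ⟶ X') (b : X' ⟶ X'') (δ : Extn S.E Z X) :
    push S.E (a ≫ b) δ = push S.E b (push S.E a δ) := by
  simp [push]

theorem push_ext_zero {Z X X' : C} (a : X ⟶ X') : push S.E a (0 : Extn S.E Z X) = 0 := by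
  simp [push]

theorem pull_id {Z X : C} (δ : Extn S.E Z X) : pull S.E (𝟙 Z) δ = δ := by
  simp [pull]

theorem pull_comp {Z Z' Z'' X : C} (a : Z'' ⟶ Z') (b : Z' ⟶ Z) (δ : Extn S.E Z X) :
    pull S.E (a ≫ b) δ = pull S.E a (pull S.E b δ) := by
  simp [pull]

theorem pull_ext_zero {Z Z' X : C} (a : Z' ⟶ Z) : pull S.E a (0 : Extn S.E Z X) = 0 := by
  simp [pull]

theorem push_sub {Z X X' : C} (a b : X ⟶ X') (δ : Extn S.E Z X) :
    push S.E (a - b) δ = push S.E a δ - push S.E b δ := by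
  have := S.additive_right Z
  simp only [push, Functor.map_sub]
  rfl

theorem push_zero {Z X X' : C} (δ : Extn S.E Z X) : push S.E (0 : X ⟶ X') δ = 0 := by
  simpa using S.push_sub (0 : X ⟶ X') 0 δ

theorem pull_zero {Z Z' X : C} (δ : Extn S.E Z X) : pull S.E (0 : Z' ⟶ Z) δ = 0 := by
  have := S.additive_left X
  have h : (S.E.flip.obj X).map (0 : Z' ⟶ Z).op = 0 := by
    rw [op_zero, Functor.map_zero]
  change ((S.E.flip.obj X).map (0 : Z' ⟶ Z).op).hom δ = 0
  rw [h]
  rfl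

end Extensions

/-! ### Exactness, comparison and splitting of triangles -/

section Triangles

variable {S}

theorem tri_of_isZero_right {X Y Z : C} (e : X ≅ Y) (hZ : IsZero Z) (y : Y ⟶ Z) :
    S.Tri e.hom y (0 : Extn S.E Z X) := by
  refine S.tri_of_iso (x := biprod.inl) (y := biprod.snd)
    { hom := biprod.fst ≫ e.hom
      inv := e.inv ≫ biprod.inl
      hom_inv_id := ?_ } ?_ ?_ (S.tri_zero X Z)
  · apply biprod.hom_ext'
    · simp
    · exact hZ.eq_of_src _ _
  · simp
  · exact hZ.eq_of_tgt _ _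

theorem tri_of_isZero_left {X Y Z : C} (e : Y ≅ Z) (hX : IsZero X) (x : X ⟶ Y) :
    S.Tri x e.hom (0 : Extn S.E Z X) := by
  refine S.tri_of_iso (x := biprod.inl) (y := biprod.snd)
    { hom := biprod.snd ≫ e.inv
      inv := e.hom ≫ biprod.inr
      hom_inv_id := ?_ } ?_ ?_ (S.tri_zero X Z)
  · apply biprod.hom_ext'
    · exact hX.eq_of_src _ _
    · simp
  · exact hX.eq_of_src _ _
  · simp

variable {X Y Z : C} {x : X ⟶ Y} {y : Y ⟶ Z} {δ : Extn S.E Z X}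

/-- Weak cokernel property: (ET3) against the trivial triangle `0 ⟶ W ⟶ W`. The other exactness
statements below likewise compare with a trivial triangle. -/
theorem Tri.factor_cone (h : S.Tri x y δ) {W : C} (b : Y ⟶ W) (hb : x ≫ b = 0) :
    ∃ c : Z ⟶ W, y ≫ c = b := by
  obtain ⟨c, hc, -⟩ := S.et3 h
    (tri_of_isZero_left (S := S) (Iso.refl W) (isZero_zero C) 0) 0 b (by simp [hb])
  exact ⟨c, by simpa using hc⟩

theorem Tri.factor_fiber (h : S.Tri x y δ) {W : C} (b : W ⟶ Y) (hb : b ≫ y = 0) :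
    ∃ a : W ⟶ X, a ≫ x = b := by
  obtain ⟨a, ha, -⟩ := S.et3_op
    (tri_of_isZero_right (S := S) (Iso.refl W) (isZero_zero C) 0) h b 0 (by simp [hb])
  exact ⟨a, by simpa using ha.symm⟩

theorem Tri.comp_eq_zero (h : S.Tri x y δ) : x ≫ y = 0 := by
  obtain ⟨c, hc, -⟩ := S.et3
    (tri_of_isZero_right (S := S) (Iso.refl X) (isZero_zero C) 0) h (𝟙 X) x (by simp)
  simpa using hc.symm

theorem Tri.push_eq_zero (h : S.Tri x y δ) : push S.E x δ = 0 := by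
  obtain ⟨c, -, hc⟩ := S.et3 h
    (tri_of_isZero_right (S := S) (Iso.refl Y) (isZero_zero C) 0) x (𝟙 Y) (by simp)
  rw [hc, pull_ext_zero]

theorem Tri.pull_eq_zero (h : S.Tri x y δ) : pull S.E y δ = 0 := by
  obtain ⟨a, -, ha⟩ := S.et3_op
    (tri_of_isZero_left (S := S) (Iso.refl Y) (isZero_zero C) 0) h (𝟙 Y) y (by simp)
  rw [← ha, push_ext_zero]

theorem Tri.factor_of_push_eq_zero (h : S.Tri x y δ) {W : C} (a : X ⟶ W)
    (ha : push S.E a δ = 0) : ∃ b : Y ⟶ W, x ≫ b = a := by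
  obtain ⟨b, hb, -⟩ := S.realize_hom h
    (tri_of_isZero_right (S := S) (Iso.refl W) (isZero_zero C) 0) a 0
    (by rw [ha, pull_ext_zero])
  exact ⟨b, by simpa using hb⟩

theorem Tri.factor_of_pull_eq_zero (h : S.Tri x y δ) {W : C} (c : W ⟶ Z)
    (hc : pull S.E c δ = 0) : ∃ b : W ⟶ Y, b ≫ y = c := by
  obtain ⟨b, -, hb⟩ := S.realize_hom
    (tri_of_isZero_left (S := S) (Iso.refl W) (isZero_zero C) 0) h 0 c
    (by rw [hc, push_ext_zero])
  exact ⟨b, by simpa using hb.symm⟩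

theorem Tri.isIso_of_isZero_left (h : S.Tri x y δ) (hX : IsZero X) : IsIso y := by
  have hδ : δ = 0 := by rw [← S.push_id δ, hX.eq_of_src (𝟙 X) 0, push_zero]
  subst hδ
  obtain ⟨e, -, he⟩ := S.tri_unique h
    (tri_of_isZero_left (S := S) (Iso.refl Z) hX 0)
  rw [← he]
  infer_instance

theorem Tri.isIso_of_isZero_right (h : S.Tri x y δ) (hZ : IsZero Z) : IsIso x := by
  have hδ : δ = 0 := by rw [← S.pull_id δ, hZ.eq_of_src (𝟙 Z) 0, pull_zero]
  subst hδ
  obtain ⟨e, he, -⟩ := S.tri_unique (tri_of_isZero_right (S := S) (Iso.refl X) hZ 0) h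
  rw [← he]
  infer_instance

/-- The difference `𝟙 Y - w` factors through `y` and is killed by `y`, so it squares to zero. -/
theorem Tri.isIso_middle (h : S.Tri x y δ) (w : Y ⟶ Y) (hx : x ≫ w = x) (hy : w ≫ y = y) :
    IsIso w := by
  obtain ⟨c, hc⟩ := h.factor_cone (𝟙 Y - w) (by simp [hx])
  apply isIso_of_sub_sq_eq_zero
  nth_rw 2 [← hc]
  rw [← Category.assoc, Preadditive.sub_comp, hy, Category.id_comp, sub_self, zero_comp]

theorem Tri.isIso_left (h : S.Tri x y δ) (w : X ⟶ X) (hx : w ≫ x = x)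
    (hw : push S.E w δ = δ) : IsIso w := by
  obtain ⟨b, hb⟩ := h.factor_of_push_eq_zero (𝟙 X - w) (by rw [push_sub, push_id, hw, sub_self])
  apply isIso_of_sub_sq_eq_zero
  nth_rw 2 [← hb]
  rw [← Category.assoc, Preadditive.sub_comp, hx, Category.id_comp, sub_self, zero_comp]

/-- Two objects that complete the same map to the first term of a triangle are isomorphic. -/
theorem Tri.fiber_iso (h : S.Tri x y δ) {X' : C} {x' : X' ⟶ Y} {δ' : Extn S.E Z X'}
    (h' : S.Tri x' y δ') : Nonempty (X ≅ X') := by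
  obtain ⟨a, ha, ha'⟩ := S.et3_op h h' (𝟙 Y) (𝟙 Z) (by simp)
  obtain ⟨b, hb, hb'⟩ := S.et3_op h' h (𝟙 Y) (𝟙 Z) (by simp)
  rw [Category.comp_id] at ha hb
  rw [pull_id] at ha' hb'
  have h₁ : IsIso (a ≫ b) := h.isIso_left _ (by rw [Category.assoc, ← hb, ← ha])
    (by rw [push_comp, ha', hb'])
  have h₂ : IsIso (b ≫ a) := h'.isIso_left _ (by rw [Category.assoc, ← ha, ← hb])
    (by rw [push_comp, hb', ha'])
  have := isIso_of_isIso_comp a b h₁ h₂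
  exact ⟨asIso a⟩

/-- Realizing the inverse of `c` gives a map back. It need not invert `f`, but both composites fix
the maps of their triangles, so `isIso_middle` applies. -/
theorem Tri.isIso_of_isIso (h : S.Tri x y δ) {Y' Z' : C} {x' : X ⟶ Y'} {y' : Y' ⟶ Z'}
    {δ' : Extn S.E Z' X} (h' : S.Tri x' y' δ') (f : Y ⟶ Y') (c : Z ⟶ Z') [IsIso c]
    (hf : x ≫ f = x') (hc : y ≫ c = f ≫ y') (hδ : δ = pull S.E c δ') : IsIso f := by
  obtain ⟨b, hb, hb'⟩ := S.realize_hom h' h (𝟙 X) (inv c)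
    (by rw [push_id, hδ, ← pull_comp, IsIso.inv_hom_id, pull_id])
  rw [Category.id_comp] at hb
  refine isIso_of_isIso_comp f b (h.isIso_middle _ ?_ ?_) (h'.isIso_middle _ ?_ ?_)
  · rw [← Category.assoc, hf, hb]
  · rw [Category.assoc, ← hb', ← Category.assoc, ← hc, Category.assoc, IsIso.hom_inv_id,
      Category.comp_id]
  · rw [← Category.assoc, hb, hf]
  · rw [Category.assoc, ← hc, ← Category.assoc, ← hb', Category.assoc, IsIso.inv_hom_id,
      Category.comp_id]

theorem tri_swap_of_split {s : Z ⟶ Y} {t : Y ⟶ X} (hxt : x ≫ t = 𝟙 X) (hsy : s ≫ y = 𝟙 Z)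
    (hst : s ≫ t = 0) (hxy : x ≫ y = 0) (htot : y ≫ s + t ≫ x = 𝟙 Y) :
    S.Tri s t (0 : Extn S.E X Z) := by
  refine S.tri_of_iso (x := biprod.inl) (y := biprod.snd)
    { hom := biprod.desc s x
      inv := biprod.lift y t
      hom_inv_id := ?_
      inv_hom_id := ?_ } ?_ ?_ (S.tri_zero Z X)
  · apply biprod.hom_ext' <;> apply biprod.hom_ext <;> simp [hxt, hsy, hst, hxy]
  · simpa using htot
  · simp
  · apply biprod.hom_ext' <;> simp [hxt, hst]

/-- A retraction of an inflation is a deflation. -/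
theorem Tri.swap_of_retraction (h : S.Tri x y δ) (t : Y ⟶ X) (ht : x ≫ t = 𝟙 X) :
    ∃ s : Z ⟶ Y, S.Tri s t (0 : Extn S.E X Z) := by
  have hδ : δ = 0 := by
    rw [← S.push_id δ, ← ht, push_comp, h.push_eq_zero, push_ext_zero]
  obtain ⟨s₀, hs₀⟩ := h.factor_of_pull_eq_zero (𝟙 Z) (by rw [hδ, pull_ext_zero])
  -- An arbitrary section `s₀` need not be killed by `t`; this corrects it by the idempotent `𝟙 Y -
  -- t ≫ x`.
  obtain ⟨c, hc⟩ := h.factor_cone (𝟙 Y - t ≫ x) (by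
    rw [Preadditive.comp_sub, ← Category.assoc, ht, Category.comp_id, Category.id_comp, sub_self])
  have hcs : c = s₀ ≫ (𝟙 Y - t ≫ x) := by rw [← hc, ← Category.assoc, hs₀, Category.id_comp]
  refine ⟨c, tri_swap_of_split (y := y) ht ?_ ?_ h.comp_eq_zero (by rw [hc]; abel)⟩
  · simp [hcs, Preadditive.sub_comp, Preadditive.comp_sub, h.comp_eq_zero, hs₀]
  · simp [hcs, Preadditive.sub_comp, Preadditive.comp_sub, ht]

/-- A section of a deflation is an inflation. -/
theorem Tri.swap_of_section (h : S.Tri x y δ) (s : Z ⟶ Y) (hs : s ≫ y = 𝟙 Z) :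
    ∃ t : Y ⟶ X, S.Tri s t (0 : Extn S.E X Z) := by
  have hδ : δ = 0 := by
    rw [← S.pull_id δ, ← hs, pull_comp, h.pull_eq_zero, pull_ext_zero]
  obtain ⟨t₀, ht₀⟩ := h.factor_of_push_eq_zero (𝟙 X) (by rw [hδ, push_ext_zero])
  obtain ⟨c, hc⟩ := h.factor_fiber (𝟙 Y - y ≫ s) (by
    rw [Preadditive.sub_comp, Category.assoc, hs, Category.comp_id, Category.id_comp, sub_self])
  have hcs : c = (𝟙 Y - y ≫ s) ≫ t₀ := by rw [← hc, Category.assoc, ht₀, Category.comp_id]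
  refine ⟨c, tri_swap_of_split (x := x) ?_ hs ?_ h.comp_eq_zero (by rw [hc]; abel)⟩
  · rw [hcs, Preadditive.sub_comp, Preadditive.comp_sub, Category.assoc,
      ← Category.assoc x y, h.comp_eq_zero]
    simp [ht₀]
  · rw [hcs, Preadditive.sub_comp, Preadditive.comp_sub, Category.assoc,
      ← Category.assoc s y, hs]
    simp

/-- `tri_of_iso` only changes the middle term. To change an end term, the isomorphism is treated as
a deflation with zero fiber and composed by (ET4)ᵒᵖ, at the cost of an isomorphic fiber. -/
theorem Tri.comp_iso (h : S.Tri x y δ) {Z' : C} (c : Z ≅ Z') :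
    ∃ (X' : C) (x' : X' ⟶ Y) (δ' : Extn S.E Z' X'),
      Nonempty (X ≅ X') ∧ S.Tri x' (y ≫ c.hom) δ' := by
  obtain ⟨L, d, e, h', δ'', h₁, -, -, h₂, -, -⟩ := S.et4_op h
    (tri_of_isZero_left (S := S) c (isZero_zero C) 0)
  have := h₂.isIso_of_isZero_right (isZero_zero C)
  exact ⟨L, h', δ'', ⟨asIso d⟩, h₁⟩

theorem Tri.iso_comp (h : S.Tri x y δ) {X' : C} (c : X' ≅ X) :
    ∃ (Z' : C) (y' : Y ⟶ Z') (δ' : Extn S.E Z' X'),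
      Nonempty (Z' ≅ Z) ∧ S.Tri (c.hom ≫ x) y' δ' := by
  obtain ⟨L, h', d, e, δ'', h₁, -, -, h₂, -, -⟩ := S.et4
    (tri_of_isZero_right (S := S) c (isZero_zero C) 0) h
  have := h₂.isIso_of_isZero_left (isZero_zero C)
  exact ⟨L, h', δ'', ⟨asIso e⟩, h₁⟩

end Triangles

end ExtriStructure

/-! ### Schur's lemma for semibricks -/

section Bricks

variable {C : Type u} [Category.{v} C] [Preadditive C] {𝒳 : ObjectProperty C}

theorem IsBrick.isIso {X : C} (hX : IsBrick X) (f : X ⟶ X) (hf : f ≠ 0) : IsIso f :=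
  (isUnit_iff_isIso f).1 (hX.2 f hf)

theorem IsBrick.id_ne_zero {X : C} (hX : IsBrick X) : 𝟙 X ≠ 0 := by
  have := hX.1
  exact one_ne_zero (α := End X)

theorem IsBrick.eq_id_of_comp_right {X Y : C} (hX : IsBrick X) (f : Y ⟶ X) (hf : f ≠ 0)
    (θ : X ⟶ X) (h : f ≫ θ = f) : θ = 𝟙 X := by
  by_contra hne
  have := hX.isIso (θ - 𝟙 X) (sub_ne_zero.2 hne)
  refine hf ((cancel_mono (θ - 𝟙 X)).1 ?_)
  rw [Preadditive.comp_sub, h, Category.comp_id, sub_self, zero_comp]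

theorem IsBrick.eq_id_of_comp_left {X Y : C} (hX : IsBrick X) (f : X ⟶ Y) (hf : f ≠ 0)
    (θ : X ⟶ X) (h : θ ≫ f = f) : θ = 𝟙 X := by
  by_contra hne
  have := hX.isIso (θ - 𝟙 X) (sub_ne_zero.2 hne)
  refine hf ((cancel_epi (θ - 𝟙 X)).1 ?_)
  rw [Preadditive.sub_comp, h, Category.id_comp, sub_self, comp_zero]

theorem IsSemibrick.isIso (h𝒳 : IsSemibrick 𝒳) {X Y : C} (hX : 𝒳 X) (hY : 𝒳 Y) (f : X ⟶ Y)
    (hf : f ≠ 0) : IsIso f := by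
  by_cases h : Nonempty (X ≅ Y)
  · obtain ⟨e⟩ := h
    have : IsIso (f ≫ e.inv) := (h𝒳.brick X hX).isIso _ fun h0 =>
      hf ((cancel_mono e.inv).1 (by rw [h0, zero_comp]))
    exact IsIso.of_isIso_comp_right f e.inv
  · exact (hf (h𝒳.hom_zero X Y hX hY h f)).elim

end Bricks

namespace ExtriStructure

variable {C : Type u} [Category.{v} C] [Preadditive C] [HasZeroObject C] [HasBinaryBiproducts C]
  {S : ExtriStructure.{w} C} {𝒳 : ObjectProperty C}

/-! ### Filtrations and removal of a factor -/

section Filtrations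

theorem HasFiltration.of_iso {n : ℕ} {M N : C} (h : S.HasFiltration 𝒳 n M) (e : M ≅ N) :
    S.HasFiltration 𝒳 n N := by
  cases h with
  | zero hM => exact .zero (hM.of_iso e.symm)
  | succ hM f g δ h hX =>
    exact .succ hM (f ≫ e.hom) (e.inv ≫ g) δ (S.tri_of_iso e rfl (by simp) h) hX

theorem hasFiltration_zero_iff {M : C} : S.HasFiltration 𝒳 0 M ↔ IsZero M :=
  ⟨fun h => by cases h; assumption, .zero⟩

theorem hasFiltration_one {X : C} (hX : 𝒳 X) : S.HasFiltration 𝒳 1 X :=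
  .succ (.zero (isZero_zero C)) 0 (𝟙 X) 0
    (tri_of_isZero_left (S := S) (Iso.refl X) (isZero_zero C) 0) hX

/-- Pulling the extension back along the last step `M' ⟶ M` gives an extension of `M'` by `X`, whose
inflation into `L` has the same cone in `𝒳`. -/
theorem HasFiltration.extension {n m : ℕ} {X L M : C} (hX : S.HasFiltration 𝒳 n X)
    (hM : S.HasFiltration 𝒳 m M) {x : X ⟶ L} {y : L ⟶ M} {δ : Extn S.E M X}
    (h : S.Tri x y δ) : S.HasFiltration 𝒳 (n + m) L := by
  induction hM generalizing L with
  | zero hM =>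
    have := h.isIso_of_isZero_right hM
    exact hX.of_iso (asIso x)
  | succ hM' f g δ' h' hT ih =>
    obtain ⟨K, d, e, k, δ'', h₁, -, -, h₂, -, -⟩ := S.et4_op h h'
    exact .succ (ih h₂) k (y ≫ g) δ'' h₁ hT

/-- A filtration can also be read from its first factor. -/
theorem HasFiltration.exists_first {n : ℕ} {M : C} (hM : S.HasFiltration 𝒳 (n + 1) M) :
    ∃ (T M' : C) (x : T ⟶ M) (y : M ⟶ M') (δ : Extn S.E M' T),
      𝒳 T ∧ S.HasFiltration 𝒳 n M' ∧ S.Tri x y δ := by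
  induction n generalizing M with
  | zero =>
    cases hM with
    | succ hM' f g δ h hX =>
      have := h.isIso_of_isZero_left (hasFiltration_zero_iff.1 hM')
      exact ⟨_, _, (asIso g).symm.hom, 0, 0, hX, .zero (isZero_zero C),
        tri_of_isZero_right (S := S) (asIso g).symm (isZero_zero C) 0⟩
  | succ n ih =>
    cases hM with
    | succ hM' f g δ h hX =>
      obtain ⟨T, M'', x, y, δ', hT, hM'', h'⟩ := ih hM'
      obtain ⟨L, k, d, e, δ'', h₁, -, -, h₂, -, -⟩ := S.et4 h' h
      exact ⟨T, L, x ≫ f, k, δ'', hT, .succ hM'' d e _ h₂ hX, h₁⟩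

theorem HasFiltration.hom_to_eq_zero {n : ℕ} {N : C} (hN : S.HasFiltration 𝒳 n N) {M : C}
    (hM : ∀ T, 𝒳 T → ∀ f : M ⟶ T, f = 0) (f : M ⟶ N) : f = 0 := by
  induction hN with
  | zero hN => exact hN.eq_of_tgt _ _
  | succ hN' x y δ h hT ih =>
    obtain ⟨a, rfl⟩ := h.factor_fiber f (hM _ hT _)
    rw [ih a, zero_comp]

theorem HasFiltration.hom_from_eq_zero {n : ℕ} {N : C} (hN : S.HasFiltration 𝒳 n N) {M : C}
    (hM : ∀ T, 𝒳 T → ∀ f : T ⟶ M, f = 0) (f : N ⟶ M) : f = 0 := by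
  induction hN with
  | zero hN => exact hN.eq_of_src _ _
  | succ hN' x y δ h hT ih =>
    obtain ⟨a, rfl⟩ := h.factor_cone f (ih _)
    rw [hM _ hT a, comp_zero]

theorem HasFiltration.exists_hom_to {n : ℕ} {M : C} (hM : S.HasFiltration 𝒳 n M)
    (h0 : ¬ IsZero M) : ∃ (T : C) (_ : 𝒳 T) (f : M ⟶ T), f ≠ 0 := by
  by_contra! hcon
  exact h0 ((IsZero.iff_id_eq_zero M).2 (hM.hom_to_eq_zero hcon _))

theorem HasFiltration.exists_hom_from {n : ℕ} {M : C} (hM : S.HasFiltration 𝒳 n M)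
    (h0 : ¬ IsZero M) : ∃ (T : C) (_ : 𝒳 T) (f : T ⟶ M), f ≠ 0 := by
  by_contra! hcon
  exact h0 ((IsZero.iff_id_eq_zero M).2 (hM.hom_from_eq_zero hcon _))

/-- A nonzero map to a member of a semibrick is a deflation whose fiber has a shorter
filtration. -/
theorem HasFiltration.exists_fiber (h𝒳 : IsSemibrick 𝒳) {n : ℕ} {M : C}
    (hM : S.HasFiltration 𝒳 n M) {T : C} (hT : 𝒳 T) (f : M ⟶ T) (hf : f ≠ 0) :
    ∃ (m : ℕ) (K : C) (k : K ⟶ M) (δ : Extn S.E T K),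
      n = m + 1 ∧ S.HasFiltration 𝒳 m K ∧ S.Tri k f δ := by
  induction hM with
  | zero hM => exact (hf (hM.eq_of_src _ _)).elim
  | @succ n M' M T' hM' x y δ h hT' ih =>
    by_cases hxf : x ≫ f = 0
    · obtain ⟨c, rfl⟩ := h.factor_cone f hxf
      have := h𝒳.isIso hT' hT c (fun h0 => hf (by rw [h0, comp_zero]))
      obtain ⟨K, k, δ', ⟨e⟩, hk⟩ := h.comp_iso (asIso c)
      exact ⟨n, K, k, δ', rfl, hM'.of_iso e, hk⟩
    · obtain ⟨m, K', k', δ', rfl, hK', h'⟩ := ih (x ≫ f) hxf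
      obtain ⟨L, q, d, e, δ'', h₁, hcomm, -, h₂, -, -⟩ := S.et4 h' h
      obtain ⟨r, rfl⟩ := h₁.factor_cone f (by rw [Category.assoc, h'.comp_eq_zero])
      -- `T` embeds in `L` with cone `T'`, and `r` splits it. So `r` is a deflation with fiber `T'`,
      -- and `f = q ≫ r` is a deflation whose fiber is an extension of `T'` by `K'`.
      have hr : d ≫ r = 𝟙 T := (h𝒳.brick T hT).eq_id_of_comp_right _ hxf _ (by
        rw [← Category.assoc, hcomm, Category.assoc])
      obtain ⟨s, hs⟩ := h₂.swap_of_retraction r hr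
      obtain ⟨K, d', e', k, δ₃, h₃, -, -, h₄, -, -⟩ := S.et4_op h₁ hs
      exact ⟨m + 1, K, k, δ₃, rfl, .succ hK' d' e' _ h₄ hT', h₃⟩

/-- A nonzero map from a member of a semibrick is an inflation whose cone has a shorter
filtration. -/
theorem HasFiltration.exists_cone (h𝒳 : IsSemibrick 𝒳) {n : ℕ} {M : C}
    (hM : S.HasFiltration 𝒳 n M) {T : C} (hT : 𝒳 T) (f : T ⟶ M) (hf : f ≠ 0) :
    ∃ (m : ℕ) (K : C) (k : M ⟶ K) (δ : Extn S.E K T),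
      n = m + 1 ∧ S.HasFiltration 𝒳 m K ∧ S.Tri f k δ := by
  induction n generalizing M with
  | zero => exact (hf ((hasFiltration_zero_iff.1 hM).eq_of_tgt _ _)).elim
  | succ n ih =>
    obtain ⟨T', M', x, y, δ, hT', hM', h⟩ := hM.exists_first
    by_cases hfy : f ≫ y = 0
    · obtain ⟨c, rfl⟩ := h.factor_fiber f hfy
      have := h𝒳.isIso hT hT' c (fun h0 => hf (by rw [h0, zero_comp]))
      obtain ⟨K, k, δ', ⟨e⟩, hk⟩ := h.iso_comp (asIso c)
      exact ⟨n, K, k, δ', rfl, hM'.of_iso e.symm, hk⟩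
    · obtain ⟨m, K', k', δ', rfl, hK', h'⟩ := ih hM' (f ≫ y) hfy
      obtain ⟨L, d, e, q, δ'', h₁, -, hcomm, h₂, -, -⟩ := S.et4_op h h'
      obtain ⟨r, rfl⟩ := h₁.factor_fiber f (by rw [← Category.assoc, h'.comp_eq_zero])
      -- Dually, `r` is an inflation with cone `T'`, so the cone of `r ≫ q` is an extension of `K'`
      -- by `T'`.
      have hr : r ≫ e = 𝟙 T := (h𝒳.brick T hT).eq_id_of_comp_left _ hfy _ (by
        rw [Category.assoc, ← hcomm, Category.assoc])
      obtain ⟨t, ht⟩ := h₂.swap_of_section r hr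
      obtain ⟨K, k, d', e', δ₃, h₃, -, -, h₄, -, -⟩ := S.et4 ht h₁
      exact ⟨m + 1, K, k, δ₃, rfl, Nat.add_comm 1 m ▸ (hasFiltration_one hT').extension hK' h₄, h₃⟩

end Filtrations

/-! ### The length function -/

section Length

variable (h𝒳 : S.IsSimpleMindedSystem 𝒳)
include h𝒳

theorem IsSimpleMindedSystem.hasFiltration (M : C) :
    S.HasFiltration 𝒳 (S.filtLength 𝒳 M) M :=
  Nat.sInf_mem (h𝒳.filt_eq_top M)

omit h𝒳 in
theorem HasFiltration.filtLength_le {n : ℕ} {M : C} (h : S.HasFiltration 𝒳 n M) :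
    S.filtLength 𝒳 M ≤ n :=
  Nat.sInf_le h

omit h𝒳 in
theorem filtLength_congr {M N : C} (e : M ≅ N) : S.filtLength 𝒳 M = S.filtLength 𝒳 N :=
  congrArg sInf (Set.ext fun _ => ⟨fun h => h.of_iso e, fun h => h.of_iso e.symm⟩)

theorem IsSimpleMindedSystem.filtLength_eq_zero_iff (M : C) :
    S.filtLength 𝒳 M = 0 ↔ IsZero M := by
  constructor
  · intro h
    exact hasFiltration_zero_iff.1 (h ▸ h𝒳.hasFiltration M)
  · intro h
    exact Nat.le_zero.1 (HasFiltration.zero h).filtLength_le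

theorem IsSimpleMindedSystem.filtLength_le {X L M : C} {x : X ⟶ L} {y : L ⟶ M}
    {δ : Extn S.E M X} (h : S.Tri x y δ) :
    S.filtLength 𝒳 L ≤ S.filtLength 𝒳 X + S.filtLength 𝒳 M :=
  ((h𝒳.hasFiltration X).extension (h𝒳.hasFiltration M) h).filtLength_le

theorem IsSimpleMindedSystem.filtLength_eq_one {T : C} (hT : 𝒳 T) : S.filtLength 𝒳 T = 1 := by
  have h₁ : S.filtLength 𝒳 T ≤ 1 := (hasFiltration_one hT).filtLength_le
  have h₂ : S.filtLength 𝒳 T ≠ 0 := fun h =>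
    (h𝒳.semibrick.brick T hT).id_ne_zero
      (((h𝒳.filtLength_eq_zero_iff T).1 h).eq_of_src _ _)
  omega

theorem IsSimpleMindedSystem.exists_stable_fiber {M T : C} (hT : 𝒳 T) (f : M ⟶ T) (hf : f ≠ 0) :
    ∃ (K : C) (k : K ⟶ M) (δ : Extn S.E T K),
      S.Tri k f δ ∧ S.filtLength 𝒳 M = S.filtLength 𝒳 K + 1 := by
  obtain ⟨m, K, k, δ, hm, hK, h⟩ := (h𝒳.hasFiltration M).exists_fiber h𝒳.semibrick hT f hf
  have h₁ := h𝒳.filtLength_le h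
  have h₂ := hK.filtLength_le
  rw [h𝒳.filtLength_eq_one hT] at h₁
  exact ⟨K, k, δ, h, by omega⟩

theorem IsSimpleMindedSystem.exists_stable_cone {M T : C} (hT : 𝒳 T) (f : T ⟶ M) (hf : f ≠ 0) :
    ∃ (K : C) (k : M ⟶ K) (δ : Extn S.E K T),
      S.Tri f k δ ∧ S.filtLength 𝒳 M = S.filtLength 𝒳 K + 1 := by
  obtain ⟨m, K, k, δ, hm, hK, h⟩ := (h𝒳.hasFiltration M).exists_cone h𝒳.semibrick hT f hf
  have h₁ := h𝒳.filtLength_le h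
  have h₂ := hK.filtLength_le
  rw [h𝒳.filtLength_eq_one hT] at h₁
  exact ⟨K, k, δ, h, by omega⟩

theorem IsSimpleMindedSystem.filtLength_le_of_retract {N K : C} (b : N ⟶ K) (k : K ⟶ N)
    (hbk : b ≫ k = 𝟙 N) : S.filtLength 𝒳 N ≤ S.filtLength 𝒳 K := by
  induction hn : S.filtLength 𝒳 N generalizing N K with
  | zero => exact Nat.zero_le _
  | succ n ih =>
    have h0 : ¬ IsZero N := fun h => by
      rw [(h𝒳.filtLength_eq_zero_iff N).2 h] at hn
      omega
    obtain ⟨T, hT, f, hf⟩ := (h𝒳.hasFiltration N).exists_hom_to h0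
    have hkf : k ≫ f ≠ 0 := fun h => hf (by
      rw [← Category.id_comp f, ← hbk, Category.assoc, h, comp_zero])
    obtain ⟨N', i, δ, hi, hN'⟩ := h𝒳.exists_stable_fiber hT f hf
    obtain ⟨K', j, δ', hj, hK'⟩ := h𝒳.exists_stable_fiber hT (k ≫ f) hkf
    obtain ⟨b', hb, hb'⟩ := S.et3_op hi hj b (𝟙 T) (by
      rw [← Category.assoc, hbk, Category.id_comp, Category.comp_id])
    obtain ⟨k', hk, hk'⟩ := S.et3_op hj hi k (𝟙 T) (by rw [Category.comp_id])
    have := hi.isIso_left (b' ≫ k')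
      (by rw [Category.assoc, ← hk, ← Category.assoc, ← hb, Category.assoc, hbk, Category.comp_id])
      (by rw [push_comp, hb', pull_id, hk', pull_id])
    -- The induced maps on fibers compose only to an automorphism of `N'`, so `k'` is corrected by
    -- its inverse.
    have := ih b' (k' ≫ inv (b' ≫ k')) (by rw [← Category.assoc, IsIso.hom_inv_id]) (by omega)
    omega

/-- If `x = 0`, the identity of `L` factors through `y`, so `L` is a retract of `M` and cannot be
longer. -/
theorem IsSimpleMindedSystem.inflation_ne_zero {X L M : C} {x : X ⟶ L} {y : L ⟶ M}
    {δ : Extn S.E M X} (h : S.Tri x y δ) (hlt : S.filtLength 𝒳 M < S.filtLength 𝒳 L) : x ≠ 0 := by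
  rintro rfl
  obtain ⟨c, hc⟩ := h.factor_cone (𝟙 L) (by simp)
  have := h𝒳.filtLength_le_of_retract _ _ hc
  omega

theorem IsSimpleMindedSystem.deflation_ne_zero {X L M : C} {x : X ⟶ L} {y : L ⟶ M}
    {δ : Extn S.E M X} (h : S.Tri x y δ) (hlt : S.filtLength 𝒳 X < S.filtLength 𝒳 L) : y ≠ 0 := by
  rintro rfl
  obtain ⟨c, hc⟩ := h.factor_fiber (𝟙 L) (by simp)
  have := h𝒳.filtLength_le_of_retract _ _ hc
  omega

theorem IsSimpleMindedSystem.le_filtLength_biprod (X M : C) :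
    S.filtLength 𝒳 X + S.filtLength 𝒳 M ≤ S.filtLength 𝒳 (X ⊞ M) := by
  induction hn : S.filtLength 𝒳 X generalizing X with
  | zero =>
    rw [Nat.zero_add]
    exact h𝒳.filtLength_le_of_retract biprod.inr biprod.snd biprod.inr_snd
  | succ n ih =>
    have h0 : ¬ IsZero X := fun h => by
      rw [(h𝒳.filtLength_eq_zero_iff X).2 h] at hn
      omega
    obtain ⟨T, hT, f, hf⟩ := (h𝒳.hasFiltration X).exists_hom_to h0
    obtain ⟨X', i, δ, hi, hX'⟩ := h𝒳.exists_stable_fiber hT f hf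
    obtain ⟨K, k, δ', hk, hK⟩ := h𝒳.exists_stable_fiber hT (biprod.fst ≫ f : X ⊞ M ⟶ T)
      (fun h => hf (by rw [← Category.id_comp f, ← biprod.inl_fst (X := X) (Y := M),
        Category.assoc, h, comp_zero]))
    obtain ⟨s, hs⟩ := (S.tri_zero X M).swap_of_retraction biprod.fst biprod.inl_fst
    -- The fiber of `biprod.fst ≫ f` is a split extension of `X'` by `M`; uniqueness of fibers
    -- identifies it with `K`.
    obtain ⟨L, d, e, q, δ'', h₁, -, -, h₂, -, -⟩ := S.et4_op hs hi
    rw [pull_ext_zero] at h₂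
    obtain ⟨e₁⟩ := hk.fiber_iso h₁
    obtain ⟨e₂, -, -⟩ := S.tri_unique h₂ (S.tri_zero M X')
    have h₃ := filtLength_congr (S := S) (𝒳 := 𝒳) (e₁ ≪≫ e₂ ≪≫ biprod.braiding M X')
    have h₄ := ih X' (by omega)
    omega

theorem IsSimpleMindedSystem.isLengthFunction : S.IsLengthFunction (S.filtLength 𝒳) where
  iso_invariant _ _ := fun ⟨e⟩ => filtLength_congr e
  eq_zero_iff := h𝒳.filtLength_eq_zero_iff
  subadditive _ _ _ h := h𝒳.filtLength_le h
  additive_of_split {X L M} x y h := by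
    obtain ⟨e, -, -⟩ := S.tri_unique h (S.tri_zero X M)
    exact le_antisymm (h𝒳.filtLength_le h)
      (filtLength_congr (S := S) (𝒳 := 𝒳) e ▸ h𝒳.le_filtLength_biprod X M)

end Length

/-! ### Admissibility of all morphisms -/

section Admissible

variable (h𝒳 : S.IsSimpleMindedSystem 𝒳)
include h𝒳

/-- A map that neither kills a nonzero map from a member of `𝒳` nor is killed by a nonzero map to
a member of `𝒳` is an isomorphism. -/
theorem IsSimpleMindedSystem.isIso_of_comp_ne_zero {M N : C} (f : M ⟶ N)
    (hmono : ∀ T, 𝒳 T → ∀ g : T ⟶ M, g ≠ 0 → g ≫ f ≠ 0)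
    (hepi : ∀ T, 𝒳 T → ∀ h : N ⟶ T, h ≠ 0 → f ≫ h ≠ 0) : IsIso f := by
  induction hn : S.filtLength 𝒳 M generalizing M N with
  | zero =>
    have hM := (h𝒳.filtLength_eq_zero_iff M).1 hn
    have hN : IsZero N := by
      by_contra h0
      obtain ⟨T, hT, h, hh⟩ := (h𝒳.hasFiltration N).exists_hom_to h0
      exact hepi T hT h hh (hM.eq_of_src _ _)
    exact ⟨0, hM.eq_of_src _ _, hN.eq_of_src _ _⟩
  | succ n ih =>
    have h0 : ¬ IsZero M := fun h => by
      rw [(h𝒳.filtLength_eq_zero_iff M).2 h] at hn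
      omega
    obtain ⟨T, hT, g, hg⟩ := (h𝒳.hasFiltration M).exists_hom_from h0
    have hgf := hmono T hT g hg
    obtain ⟨M', p, δ, hp, hM'⟩ := h𝒳.exists_stable_cone hT g hg
    obtain ⟨N', q, ε, hq, hN'⟩ := h𝒳.exists_stable_cone hT (g ≫ f) hgf
    obtain ⟨f', hf', hδ⟩ := S.et3 hp hq (𝟙 T) f (by simp)
    rw [push_id] at hδ
    suffices IsIso f' from hp.isIso_of_isIso hq f f' rfl hf' hδ
    -- Both conditions pass to the map `f'` on cones: a violation for `f'` would yield one for `f`.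
    refine ih f' ?_ ?_ (by omega)
    · intro T' hT' g' hg' hzero
      obtain ⟨M'', r, δ', hr, hM''⟩ := h𝒳.exists_stable_cone hT' g' hg'
      -- `P` is the preimage of `T'` in `M`. On it `f` lands in `T`, which splits `P`, and the
      -- complement `T'` is killed by `f`. Its inclusion into `M` is nonzero because its cone has
      -- length at most that of `M''` plus one, less than that of `M`.
      obtain ⟨P, d, e, i, δ'', h₁, hdi, hie, h₂, -, -⟩ := S.et4_op hp hr
      obtain ⟨t, ht⟩ := hq.factor_fiber (i ≫ f) (by
        rw [Category.assoc, ← hf', ← Category.assoc, hie, Category.assoc, hzero, comp_zero])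
      have hdt : d ≫ t = 𝟙 T := (h𝒳.semibrick.brick T hT).eq_id_of_comp_left _ hgf _ (by
        rw [Category.assoc, ht, ← Category.assoc, hdi])
      obtain ⟨s, hs⟩ := h₂.swap_of_retraction t hdt
      obtain ⟨Q, k, d', e', δ₃, h₃, -, -, h₄, -, -⟩ := S.et4 hs h₁
      have hQ := h𝒳.filtLength_le h₄
      rw [h𝒳.filtLength_eq_one hT] at hQ
      refine hmono T' hT' (s ≫ i) (h𝒳.inflation_ne_zero h₃ (by omega)) ?_
      rw [Category.assoc, ← ht, ← Category.assoc, hs.comp_eq_zero, zero_comp]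
    · intro T' hT' h hh hzero
      obtain ⟨K, k, δ', hk, hK⟩ := h𝒳.exists_stable_fiber hT' h hh
      -- The fiber of `q ≫ h` is an extension of `K` by `T`, hence shorter than `N`, so `q ≫ h` is
      -- nonzero although `f` composes with it to zero.
      obtain ⟨L, d, e, i, δ'', h₁, -, -, h₂, -, -⟩ := S.et4_op hq hk
      have hL := h𝒳.filtLength_le h₂
      rw [h𝒳.filtLength_eq_one hT] at hL
      refine hepi T' hT' (q ≫ h) (h𝒳.deflation_ne_zero h₁ (by omega)) ?_
      rw [← Category.assoc, ← hf', Category.assoc, hzero, comp_zero]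

/-- The fiber of the composite is an extension of the two fibers; subadditivity for it and for the
composite triangle squeezes the lengths to equality. -/
theorem IsSimpleMindedSystem.isDeflation_comp {L M N : C} {f : L ⟶ M} {g : M ⟶ N}
    (hf : S.IsDeflation (S.filtLength 𝒳) f) (hg : S.IsDeflation (S.filtLength 𝒳) g) :
    S.IsDeflation (S.filtLength 𝒳) (f ≫ g) := by
  obtain ⟨X, x, δ, hx, hlx⟩ := hf
  obtain ⟨Y, y, ε, hy, hly⟩ := hg
  obtain ⟨K, d, e, k, δ'', h₁, -, -, h₂, -, -⟩ := S.et4_op hx hy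
  have := h𝒳.filtLength_le h₁
  have := h𝒳.filtLength_le h₂
  exact ⟨K, k, δ'', h₁, by omega⟩

theorem IsSimpleMindedSystem.isInflation_comp {L M N : C} {f : L ⟶ M} {g : M ⟶ N}
    (hf : S.IsInflation (S.filtLength 𝒳) f) (hg : S.IsInflation (S.filtLength 𝒳) g) :
    S.IsInflation (S.filtLength 𝒳) (f ≫ g) := by
  obtain ⟨X, x, δ, hx, hlx⟩ := hf
  obtain ⟨Y, y, ε, hy, hly⟩ := hg
  obtain ⟨K, k, d, e, δ'', h₁, -, -, h₂, -, -⟩ := S.et4 hx hy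
  have := h𝒳.filtLength_le h₁
  have := h𝒳.filtLength_le h₂
  exact ⟨K, k, δ'', h₁, by omega⟩

theorem IsSimpleMindedSystem.isInflation_of_iso {M N : C} (e : M ≅ N) :
    S.IsInflation (S.filtLength 𝒳) e.hom :=
  ⟨_, 0, 0, tri_of_isZero_right e (isZero_zero C) 0, by
    rw [(h𝒳.filtLength_eq_zero_iff _).2 (isZero_zero C), Nat.add_zero, filtLength_congr e]⟩

theorem IsSimpleMindedSystem.isDeflation_of_iso {M N : C} (e : M ≅ N) :
    S.IsDeflation (S.filtLength 𝒳) e.hom :=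
  ⟨_, 0, 0, tri_of_isZero_left e (isZero_zero C) 0, by
    rw [(h𝒳.filtLength_eq_zero_iff _).2 (isZero_zero C), Nat.zero_add, filtLength_congr e]⟩

theorem IsSimpleMindedSystem.isAdmissible {M N : C} (f : M ⟶ N) :
    S.IsAdmissible (S.filtLength 𝒳) f := by
  induction hn : S.filtLength 𝒳 M + S.filtLength 𝒳 N using Nat.strong_induction_on
    generalizing M N with
  | _ n ih =>
    by_cases hmono : ∀ T, 𝒳 T → ∀ g : T ⟶ M, g ≠ 0 → g ≫ f ≠ 0
    · by_cases hepi : ∀ T, 𝒳 T → ∀ h : N ⟶ T, h ≠ 0 → f ≫ h ≠ 0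
      · have := h𝒳.isIso_of_comp_ne_zero f hmono hepi
        exact ⟨M, 𝟙 M, f, h𝒳.isDeflation_of_iso (Iso.refl M), h𝒳.isInflation_of_iso (asIso f),
          Category.id_comp f⟩
      · push Not at hepi
        obtain ⟨T, hT, h, hh, hfh⟩ := hepi
        obtain ⟨K, k, δ, hk, hK⟩ := h𝒳.exists_stable_fiber hT h hh
        obtain ⟨f', rfl⟩ := hk.factor_fiber f hfh
        obtain ⟨X, i, j, hi, hj, rfl⟩ := ih _ (by omega) f' rfl
        exact ⟨X, i, j ≫ k, hi, h𝒳.isInflation_comp hj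
          ⟨T, h, δ, hk, by rw [h𝒳.filtLength_eq_one hT, hK]⟩, (Category.assoc _ _ _).symm⟩
    · push Not at hmono
      obtain ⟨T, hT, g, hg, hgf⟩ := hmono
      obtain ⟨K, k, δ, hk, hK⟩ := h𝒳.exists_stable_cone hT g hg
      obtain ⟨f', rfl⟩ := hk.factor_cone f hgf
      obtain ⟨X, i, j, hi, hj, rfl⟩ := ih _ (by omega) f' rfl
      exact ⟨X, k ≫ i, j, h𝒳.isDeflation_comp
        ⟨T, g, δ, hk, by rw [h𝒳.filtLength_eq_one hT, hK, Nat.add_comm]⟩ hi, hj,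
        Category.assoc _ _ _⟩

end Admissible

end ExtriStructure

end Extri

theorem theorem3 {C : Type u} [Category.{v} C] [Preadditive C] [HasZeroObject C]
    [HasBinaryBiproducts C]
    (S : Extri.ExtriStructure.{w} C) (𝒳 : ObjectProperty C)
    (h𝒳 : S.IsSimpleMindedSystem 𝒳) :
    S.IsLengthCategory (S.filtLength 𝒳) := by
  exact ⟨h𝒳.isLengthFunction, h𝒳.isAdmissible⟩
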